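/- Let $\mathbf q=(q_0,q_1,q_2,\dots)$ be a probability distribution on the nonnegative integers with mean $\mu=\sum_{i\ge 0} i\,q_i$, and let $\mathrm{GW}_\infty$ be the Galton--Watson tree with offspring distribution $\mathbf q$: the random rooted tree in which the numbers of children of the vertices are independent, each equal to $i$ with probability $q_i$. Let $Z_n$ be the number of vertices at graph distance $n$ from the root, and let $\mathrm{GW}_n$ be the finite tree induced by the vertices at graph distance at most $n$ from the root. Assume that the tree is supercritical, i.e. $\mu>1$, that $q_0=0$ and $q_1\neq 1$, and that $$\mathbb E\bigl[Z_1\max\{\log Z_1,0\}\bigr]<\infty .$$ For an integer $\ell\ge 1$, an $\ell$-box in a graph $G$ is a subgraph $H$ of $G$ such that $d_H(u,v)\le \ell-1$ for all vertices $u,v$ of $H$, where $d_H$ is the graph distance within $H$. Let $N_B^n(\ell)$ be the minimum number of $\ell$-boxes needed to cover all vertices of $\mathrm{GW}_n$, and let $|\mathrm{GW}_n|$ be the number of vertices of $\mathrm{GW}_n$. Then almost surely the transfinite fractal dimension $\tau(\mathrm{GW}_\infty)$ of the sequence $(\mathrm{GW}_n)_{n\ge 1}$ exists and equals $(\log\mu)/2$.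 That is, almost surely the limit $$t_\ell=\lim_{n\to\infty}\frac{\log\bigl(N_B^n(\ell)/|\mathrm{GW}_n|\bigr)}{-\ell}$$ exists in $\mathbb R$ for every integer $\ell\ge 1$, and $$\lim_{\ell\to\infty}t_\ell=\frac{\log\mu}{2}.$$ -/

import Mathlib

open MeasureTheory ProbabilityTheory Filter Topology

noncomputable section

/-- A subgraph `H` of `G` is an `ℓ`-box if `d_H(u, v) ≤ ℓ - 1` for all vertices `u, v` of `H`, where
`d_H` is the graph distance inside `H` (infinite between different components of `H`). -/
def IsBox {V : Type*} {G : SimpleGraph V} (ℓ : ℕ) (H : G.Subgraph) : Prop :=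
  ∀ u v : H.verts, H.coe.edist u v + 1 ≤ (ℓ : ℕ∞)

/-- The minimum number of `ℓ`-boxes needed to cover all vertices of `G`. It is only used for `ℓ ≥ 1`
and finite `G`, where a cover exists (by single vertices). -/
def boxNumber {V : Type*} (G : SimpleGraph V) (ℓ : ℕ) : ℕ :=
  sInf {m : ℕ | ∃ S : Finset G.Subgraph,
    S.card = m ∧ (∀ H ∈ S, IsBox ℓ H) ∧ ∀ v : V, ∃ H ∈ S, v ∈ H.verts}

/-- The graph sequence `(G n)` has transfinite fractal dimension `τ`: for every box size `ℓ ≥ 1` the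
inner limit `t ℓ = lim_{n → ∞} log (N_B^n(ℓ) / |G_n|) / (-ℓ)` exists, and `lim_{ℓ → ∞} t ℓ = τ`. -/
def HasTransfiniteDim {V : ℕ → Type*} (G : (n : ℕ) → SimpleGraph (V n)) (τ : ℝ) : Prop :=
  ∃ t : ℕ → ℝ,
    (∀ ℓ : ℕ, 1 ≤ ℓ →
      Tendsto (fun n : ℕ =>
        Real.log ((boxNumber (G n) ℓ : ℝ) / (Nat.card (V n) : ℝ)) / (-(ℓ : ℝ))) atTop (𝓝 (t ℓ))) ∧
    Tendsto t atTop (𝓝 τ)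

/-- The vertices at graph distance `n` from `r`. -/
def generation {V : Type*} (G : SimpleGraph V) (r : V) (n : ℕ) : Set V :=
  {v | G.edist r v = (n : ℕ∞)}

/-- The union of the generations `0, …, n`. -/
def truncVerts {V : Type*} (G : SimpleGraph V) (r : V) (n : ℕ) : Set V :=
  ⋃ i ≤ n, generation G r i

/-- The truncation at height `n` of the graph `G` rooted at `r`. -/
def truncGraph {V : Type*} (G : SimpleGraph V) (r : V) (n : ℕ) :
    SimpleGraph (truncVerts G r n) :=
  G.induce (truncVerts G r n)

/-- Ulam-Harris labels. The root is `[]`, and the `i`-th child of `u` is `i :: u`. If the individual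
with label `u` has `k u` children (those with indices `i < k u`), this says that the given label
belongs to the family tree. -/
def IsLabel (k : List ℕ → ℕ) : List ℕ → Prop
  | [] => True
  | i :: u => i < k u ∧ IsLabel k u

/-- The vertices of the family tree with offspring numbers `k`. -/
abbrev TreeVertex (k : List ℕ → ℕ) : Type := {u : List ℕ // IsLabel k u}

/-- The root of the family tree. -/
def treeRoot (k : List ℕ → ℕ) : TreeVertex k := ⟨[], trivial⟩

/-- The family tree as a graph: its edges join each vertex to its children. -/
def familyTree (k : List ℕ → ℕ) : SimpleGraph (TreeVertex k) where
  Adj u v := (∃ i : ℕ, v.1 = i :: u.1) ∨ (∃ i : ℕ, u.1 = i :: v.1)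
  symm := ⟨fun _ _ h => h.symm⟩
  loopless := ⟨fun u h => by
    rcases h with ⟨i, h⟩ | ⟨i, h⟩ <;> simpa using congrArg List.length h⟩

/-- The number `Z_n` of vertices of the family tree in generation `n`. -/
def generationSize (k : List ℕ → ℕ) (n : ℕ) : ℕ :=
  (generation (familyTree k) (treeRoot k) n).ncard

/-- The mean `∑ i q_i` of an offspring distribution. -/
def offspringMean (q : PMF ℕ) : ℝ := ∑' i : ℕ, (i : ℝ) * (q i).toReal

end

/-! ### Labels of bounded length -/

/-! Write S_n and Z_n for the sizes of the ball and of generation n. Since q_0 = 0, almost surely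
the tree has no leaves.

Deterministic half: put r = ⌊(ℓ-1)/2⌋ and call the vertices of generations n - r - ℓj, j ≥ 0,
centers. The descendants of a center within r generations, together with its ancestors within ℓ-1-r
generations, form an ℓ-box. These boxes and one box at the root cover the truncated tree
(`exists_center_of_length_le`). Conversely, following first children for r steps from each center
gives vertices no two of which share an ℓ-box (`eq_of_common_suffix`). So the box number equals the
number of centers up to an error of one.

If S_{n+1}/S_n → μ, then Z_{n-i}/S_n → (1-μ⁻¹)μ^{-i}, and summing over the centers gives the density
(1-μ⁻¹)μ^{-r}/(1-μ^{-ℓ}). As r ~ ℓ/2, its logarithm divided by -ℓ tends to (log μ)/2.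

Probabilistic half: listed in breadth-first order, the offspring numbers are again i.i.d. with law q
(`map_bfsOffspring_fin`), and S_{n+1} = 1 + the sum of the first S_n of them. The strong law of
large numbers gives S_{n+1}/S_n → μ almost surely. -/

theorem IsLabel.of_suffix {k : List ℕ → ℕ} {u v : List ℕ} (hu : IsLabel k u) (h : v <:+ u) :
    IsLabel k v := by
  induction u with
  | nil => simpa [List.suffix_nil.1 h] using hu
  | cons i u ih =>
    rcases List.suffix_cons_iff.1 h with rfl | h
    · exact hu
    · exact ih hu.2 h

theorem isLabel_replicate_zero_append {k : List ℕ → ℕ} (hk : ∀ u, 1 ≤ k u) {u : List ℕ}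
    (hu : IsLabel k u) (r : ℕ) : IsLabel k (List.replicate r 0 ++ u) := by
  induction r with
  | zero => simpa using hu
  | succ r ih => exact ⟨hk _, ih⟩

/-- The labels of length `n` in the family tree with offspring numbers `k`. -/
def levelLabels (k : List ℕ → ℕ) : ℕ → Finset (List ℕ)
  | 0 => {[]}
  | n + 1 => (levelLabels k n).biUnion fun u => (Finset.range (k u)).image (· :: u)

theorem mem_levelLabels {k : List ℕ → ℕ} {n : ℕ} {u : List ℕ} :
    u ∈ levelLabels k n ↔ IsLabel k u ∧ u.length = n := by
  induction n generalizing u with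
  | zero =>
    simp only [levelLabels, Finset.mem_singleton, List.length_eq_zero_iff]
    exact ⟨fun h => ⟨h ▸ trivial, h⟩, fun h => h.2⟩
  | succ n ih =>
    simp only [levelLabels, Finset.mem_biUnion, Finset.mem_image, Finset.mem_range, ih]
    constructor
    · rintro ⟨v, ⟨hv, hl⟩, i, hi, rfl⟩
      exact ⟨⟨hi, hv⟩, by simp [hl]⟩
    · rintro ⟨hu, hl⟩
      cases u with
      | nil => simp at hl
      | cons i v => exact ⟨v, ⟨hu.2, by simpa using hl⟩, i, hu.1, rfl⟩

/-- The labels of length at most `n` in the family tree with offspring numbers `k`. -/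
def ballLabels (k : List ℕ → ℕ) (n : ℕ) : Finset (List ℕ) :=
  (Finset.range (n + 1)).biUnion (levelLabels k)

theorem mem_ballLabels {k : List ℕ → ℕ} {n : ℕ} {u : List ℕ} :
    u ∈ ballLabels k n ↔ IsLabel k u ∧ u.length ≤ n := by
  simp [ballLabels, mem_levelLabels, and_comm]

theorem disjoint_levelLabels {k : List ℕ → ℕ} {m n : ℕ} (h : m ≠ n) :
    Disjoint (levelLabels k m) (levelLabels k n) :=
  Finset.disjoint_left.2 fun _ hm hn =>
    h ((mem_levelLabels.1 hm).2.symm.trans (mem_levelLabels.1 hn).2)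

theorem card_ballLabels_succ (k : List ℕ → ℕ) (n : ℕ) :
    (ballLabels k (n + 1)).card = (ballLabels k n).card + (levelLabels k (n + 1)).card := by
  have h (m : ℕ) : (ballLabels k m).card = ∑ i ∈ Finset.range (m + 1), (levelLabels k i).card :=
    Finset.card_biUnion fun _ _ _ _ hij => disjoint_levelLabels hij
  rw [h, h, Finset.sum_range_succ]

theorem card_ballLabels_zero (k : List ℕ → ℕ) : (ballLabels k 0).card = 1 := by
  simp [ballLabels, levelLabels]

theorem card_levelLabels_pos {k : List ℕ → ℕ} (hk : ∀ u, 1 ≤ k u) (n : ℕ) :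
    0 < (levelLabels k n).card :=
  Finset.card_pos.2 ⟨List.replicate n 0 ++ [], mem_levelLabels.2
    ⟨isLabel_replicate_zero_append (u := []) hk trivial n, by simp⟩⟩

theorem lt_card_ballLabels {k : List ℕ → ℕ} (hk : ∀ u, 1 ≤ k u) (n : ℕ) :
    n < (ballLabels k n).card := by
  induction n with
  | zero => simp [card_ballLabels_zero]
  | succ n ih =>
    have := card_levelLabels_pos hk (n + 1)
    rw [card_ballLabels_succ]
    omega

/-! ### Breadth-first enumeration -/

/-- The labels found by the breadth-first search of the family tree after it has explored `j`
vertices, in the order of their discovery. -/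
def bfsQueue (k : List ℕ → ℕ) : ℕ → List (List ℕ)
  | 0 => [[]]
  | j + 1 => bfsQueue k j ++
      (List.range (k ((bfsQueue k j).getD j []))).map (· :: (bfsQueue k j).getD j [])

/-- The `j`-th vertex in breadth-first order. -/
def bfsVertex (k : List ℕ → ℕ) (j : ℕ) : List ℕ := (bfsQueue k j).getD j []

theorem bfsQueue_succ (k : List ℕ → ℕ) (j : ℕ) :
    bfsQueue k (j + 1) =
      bfsQueue k j ++ (List.range (k (bfsVertex k j))).map (· :: bfsVertex k j) := rfl

/-- The search up to step j consults `k` only at the vertices already explored; this is what makes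
the next label independent of its own offspring number. -/
theorem bfsQueue_congr {k k' : List ℕ → ℕ} {j : ℕ}
    (h : ∀ i < j, k (bfsVertex k i) = k' (bfsVertex k i)) : bfsQueue k j = bfsQueue k' j := by
  induction j with
  | zero => rfl
  | succ j ih =>
    have hq := ih fun i hi => h i (by omega)
    have hv : bfsVertex k j = bfsVertex k' j := by simp only [bfsVertex, hq]
    rw [bfsQueue_succ, bfsQueue_succ, ← hq, ← hv, h j (by omega)]

theorem bfsVertex_congr {k k' : List ℕ → ℕ} {j : ℕ}
    (h : ∀ i < j, k (bfsVertex k i) = k' (bfsVertex k i)) : bfsVertex k j = bfsVertex k' j := by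
  rw [bfsVertex, bfsVertex, bfsQueue_congr h]

theorem length_bfsQueue (k : List ℕ → ℕ) (j : ℕ) :
    (bfsQueue k j).length = 1 + ∑ i ∈ Finset.range j, k (bfsVertex k i) := by
  induction j with
  | zero => rfl
  | succ j ih => rw [bfsQueue_succ, Finset.sum_range_succ]; simp [ih, add_assoc]

/-- Without leaves the search never runs out of vertices, so the default `[]` of `getD` is never
used. -/
theorem lt_length_bfsQueue {k : List ℕ → ℕ} (hk : ∀ u, 1 ≤ k u) (j : ℕ) :
    j < (bfsQueue k j).length := by
  have : ∑ i ∈ Finset.range j, 1 ≤ ∑ i ∈ Finset.range j, k (bfsVertex k i) :=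
    Finset.sum_le_sum fun _ _ => hk _
  rw [length_bfsQueue]
  simp at this
  omega

theorem bfsQueue_prefix (k : List ℕ → ℕ) {i j : ℕ} (h : i ≤ j) :
    bfsQueue k i <+: bfsQueue k j := by
  induction j, h using Nat.le_induction with
  | base => exact List.prefix_rfl
  | succ j _ ih => exact ih.trans (bfsQueue_succ k j ▸ List.prefix_append _ _)

theorem getElem_bfsQueue {k : List ℕ → ℕ} (hk : ∀ u, 1 ≤ k u) {i j : ℕ}
    (h : i < (bfsQueue k j).length) : (bfsQueue k j)[i] = bfsVertex k i := by
  have hi := lt_length_bfsQueue hk i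
  have hv : bfsVertex k i = (bfsQueue k i)[i] := List.getD_eq_getElem _ _ hi
  rw [hv]
  rcases le_total i j with hij | hij
  · exact ((bfsQueue_prefix k hij).getElem hi).symm
  · exact (bfsQueue_prefix k hij).getElem h

theorem mem_bfsQueue_iff_exists {k : List ℕ → ℕ} (hk : ∀ u, 1 ≤ k u) {j : ℕ} {u : List ℕ} :
    u ∈ bfsQueue k j ↔ ∃ i < (bfsQueue k j).length, bfsVertex k i = u := by
  rw [List.mem_iff_getElem]
  constructor
  · rintro ⟨i, hi, rfl⟩
    exact ⟨i, hi, (getElem_bfsQueue hk hi).symm⟩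
  · rintro ⟨i, hi, rfl⟩
    exact ⟨i, hi, getElem_bfsQueue hk hi⟩

theorem mem_bfsQueue {k : List ℕ → ℕ} {j : ℕ} {u : List ℕ} :
    u ∈ bfsQueue k j ↔
      u = [] ∨ ∃ i < j, ∃ c < k (bfsVertex k i), u = c :: bfsVertex k i := by
  induction j with
  | zero => simp [bfsQueue]
  | succ j ih =>
    rw [bfsQueue_succ, List.mem_append, ih]
    simp only [List.mem_map, List.mem_range, Nat.lt_succ_iff_lt_or_eq, or_and_right, exists_or,
      exists_eq_left, or_assoc, eq_comm (a := u)]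

theorem nodup_bfsQueue {k : List ℕ → ℕ} (hk : ∀ u, 1 ≤ k u) (j : ℕ) : (bfsQueue k j).Nodup := by
  induction j with
  | zero => simp [bfsQueue]
  | succ j ih =>
    rw [bfsQueue_succ]
    refine ih.append (List.nodup_range.map fun a b h => (List.cons.inj h).1) ?_
    intro u hu hu'
    obtain ⟨c, -, rfl⟩ := List.mem_map.1 hu'
    -- A repeated label would be a child of an earlier vertex i < j equal to vertex j, against `ih`.
    rcases mem_bfsQueue.1 hu with h | ⟨i, hi, d, -, h⟩
    · simp at h
    · have hj := lt_length_bfsQueue hk j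
      have h' : (bfsQueue k j)[j] = (bfsQueue k j)[i]'(hi.trans hj) := by
        rw [getElem_bfsQueue hk, getElem_bfsQueue hk]; exact (List.cons.inj h).2
      have := (ih.getElem_inj_iff).1 h'
      omega

theorem injective_bfsVertex {k : List ℕ → ℕ} (hk : ∀ u, 1 ≤ k u) :
    Function.Injective (bfsVertex k) := by
  intro i j h
  have hi : i < (bfsQueue k (max i j)).length :=
    (le_max_left i j).trans_lt (lt_length_bfsQueue hk _)
  have hj : j < (bfsQueue k (max i j)).length :=
    (le_max_right i j).trans_lt (lt_length_bfsQueue hk _)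
  rw [← getElem_bfsQueue hk hi, ← getElem_bfsQueue hk hj] at h
  exact ((nodup_bfsQueue hk _).getElem_inj_iff).1 h

theorem mem_ballLabels_succ {k : List ℕ → ℕ} {n : ℕ} {u : List ℕ} :
    u ∈ ballLabels k (n + 1) ↔ u = [] ∨ ∃ v ∈ ballLabels k n, ∃ c < k v, u = c :: v := by
  cases u with
  | nil => simp [mem_ballLabels, IsLabel]
  | cons i u =>
    simp only [mem_ballLabels, IsLabel, List.length_cons, add_le_add_iff_right, reduceCtorEq,
      false_or, List.cons.injEq]
    constructor
    · rintro ⟨⟨h, h'⟩, hl⟩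
      exact ⟨u, ⟨h', hl⟩, i, h, rfl, rfl⟩
    · rintro ⟨v, ⟨h', hl⟩, c, h, rfl, rfl⟩
      exact ⟨⟨h, h'⟩, hl⟩

theorem toFinset_bfsQueue {k : List ℕ → ℕ} {n m : ℕ}
    (h : ∀ u, u ∈ ballLabels k n ↔ ∃ i < m, bfsVertex k i = u) :
    (bfsQueue k m).toFinset = ballLabels k (n + 1) := by
  ext u
  rw [List.mem_toFinset, mem_bfsQueue, mem_ballLabels_succ]
  simp [h]

theorem card_ballLabels_succ_of_mem {k : List ℕ → ℕ} (hk : ∀ u, 1 ≤ k u) {n m : ℕ}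
    (h : ∀ u, u ∈ ballLabels k n ↔ ∃ i < m, bfsVertex k i = u) :
    (ballLabels k (n + 1)).card = (bfsQueue k m).length := by
  rw [← toFinset_bfsQueue h, List.toFinset_card_of_nodup (nodup_bfsQueue hk m)]

/-- Once exactly the ball of radius n has been explored, the queue is the ball of radius n + 1;
induct on n. -/
theorem mem_ballLabels_iff_bfsVertex {k : List ℕ → ℕ} (hk : ∀ u, 1 ≤ k u) (n : ℕ) (u : List ℕ) :
    u ∈ ballLabels k n ↔ ∃ i < (ballLabels k n).card, bfsVertex k i = u := by
  induction n generalizing u with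
  | zero => simp [ballLabels, levelLabels, bfsVertex, bfsQueue, eq_comm]
  | succ n ih =>
    rw [card_ballLabels_succ_of_mem hk ih, ← mem_bfsQueue_iff_exists hk, ← toFinset_bfsQueue ih,
      List.mem_toFinset]

/-- The vertices of the generations `0, …, n` are the first ones in breadth-first order, and the
vertices of the generations `0, …, n + 1` are the root and their children. -/
theorem card_ballLabels_succ_eq_sum {k : List ℕ → ℕ} (hk : ∀ u, 1 ≤ k u) (n : ℕ) :
    (ballLabels k (n + 1)).card =
      1 + ∑ i ∈ Finset.range (ballLabels k n).card, k (bfsVertex k i) := by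
  rw [card_ballLabels_succ_of_mem hk (mem_ballLabels_iff_bfsVertex hk n), length_bfsQueue]

/-! ### Distances in the family tree -/

/-- Lower bound for tree distances: a walk must descend to a common ancestor `w` and climb again. In
the induction `w` changes only when it is the child just entered, and is then replaced by its
parent. -/
theorem exists_common_suffix_of_walk {k : List ℕ → ℕ} {u v : TreeVertex k}
    (p : (familyTree k).Walk u v) :
    ∃ w, w <:+ u.1 ∧ w <:+ v.1 ∧ u.1.length + v.1.length ≤ p.length + 2 * w.length := by
  induction p with
  | @nil u => exact ⟨u.1, List.suffix_rfl, List.suffix_rfl, by simp; omega⟩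
  | @cons u u' v h p ih =>
    obtain ⟨w, hwu, hwv, hw⟩ := ih
    rw [SimpleGraph.Walk.length_cons]
    rcases h with ⟨i, h⟩ | ⟨i, h⟩
    · have hl : u'.1.length = u.1.length + 1 := by rw [h]; rfl
      rcases List.suffix_cons_iff.1 (h ▸ hwu) with h' | h'
      · have hl' : w.length = u.1.length + 1 := by rw [h']; rfl
        exact ⟨u.1, List.suffix_rfl, (List.suffix_cons i u.1).trans (h' ▸ hwv), by omega⟩
      · exact ⟨w, h', hwv, by omega⟩
    · have hl : u.1.length = u'.1.length + 1 := by rw [h]; rfl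
      exact ⟨w, hwu.trans (h ▸ List.suffix_cons i u'.1), hwv, by omega⟩

/-- Removing labels one by one gives a path from descendant to ancestor. The labelling `f` is
abstract so that this applies both to the whole tree and inside a box. -/
theorem edist_add_length_le_of_suffix {α : Type*} {G : SimpleGraph α} {f : α → List ℕ}
    (hf : Function.Injective f) (hadj : ∀ x y i, f x = i :: f y → G.Adj x y) {x y : α}
    (hyx : f y <:+ f x) (hmem : ∀ v, f y <:+ v → v <:+ f x → ∃ z, f z = v) :
    G.edist x y + (f y).length ≤ (f x).length := by
  obtain ⟨l, hl⟩ := hyx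
  induction l generalizing x with
  | nil =>
    obtain rfl : y = x := hf hl
    simp
  | cons i l ih =>
    obtain ⟨z, hz⟩ := hmem (l ++ f y) (List.suffix_append _ _) (hl ▸ List.suffix_cons i _)
    have hxz : f x = i :: f z := by rw [hz, ← hl]; rfl
    have h := ih (fun v h h' => hmem v h (h'.trans (hxz ▸ List.suffix_cons i _))) hz.symm
    calc G.edist x y + (f y).length ≤ G.edist x z + G.edist z y + (f y).length := by
          gcongr; exact G.edist_triangle
      _ ≤ 1 + (f z).length := by
          rw [SimpleGraph.edist_eq_one_iff_adj.2 (hadj x z i hxz), add_assoc]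
          gcongr
      _ = (f x).length := by rw [hxz, List.length_cons]; push_cast; ring

theorem edist_treeRoot (k : List ℕ → ℕ) (u : TreeVertex k) :
    (familyTree k).edist (treeRoot k) u = u.1.length := by
  have h : (familyTree k).edist (treeRoot k) u ≤ u.1.length := by
    have := edist_add_length_le_of_suffix (G := familyTree k) (f := Subtype.val) (x := u)
      (y := treeRoot k) Subtype.val_injective (fun x y i h => Or.inr ⟨i, h⟩) (List.nil_suffix)
      (fun v _ hv => ⟨⟨v, u.2.of_suffix hv⟩, rfl⟩)
    rw [SimpleGraph.edist_comm]
    simpa [treeRoot] using this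
  refine le_antisymm h ?_
  obtain ⟨p, hp⟩ := SimpleGraph.exists_walk_of_edist_ne_top (ne_top_of_le_ne_top (by simp) h)
  obtain ⟨w, hw, -, h'⟩ := exists_common_suffix_of_walk p
  rw [← hp]
  have : w = [] := List.suffix_nil.1 hw
  subst this
  simp [treeRoot] at h'
  exact_mod_cast h'

theorem mem_truncVerts {k : List ℕ → ℕ} {n : ℕ} {u : TreeVertex k} :
    u ∈ truncVerts (familyTree k) (treeRoot k) n ↔ u.1.length ≤ n := by
  simp [truncVerts, generation, edist_treeRoot]

/-- The vertices of the family tree with offspring numbers `k` truncated at height `n`. -/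
abbrev TruncVertex (k : List ℕ → ℕ) (n : ℕ) : Type :=
  truncVerts (familyTree k) (treeRoot k) n

/-- The vertex of the truncated tree with a given label. -/
def TruncVertex.mk {k : List ℕ → ℕ} {n : ℕ} (u : List ℕ) (hu : IsLabel k u) (hn : u.length ≤ n) :
    TruncVertex k n := ⟨⟨u, hu⟩, mem_truncVerts.2 hn⟩

theorem length_truncVertex_le {k : List ℕ → ℕ} {n : ℕ} (v : TruncVertex k n) :
    v.1.1.length ≤ n := mem_truncVerts.1 v.2

theorem card_truncVerts (k : List ℕ → ℕ) (n : ℕ) :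
    Nat.card (TruncVertex k n) = (ballLabels k n).card := by
  have e : TruncVertex k n ≃ ballLabels k n :=
    { toFun := fun v => ⟨v.1.1, mem_ballLabels.2 ⟨v.1.2, length_truncVertex_le v⟩⟩
      invFun := fun u =>
        TruncVertex.mk u.1 (mem_ballLabels.1 u.2).1 (mem_ballLabels.1 u.2).2
      left_inv := fun _ => rfl
      right_inv := fun _ => rfl }
  rw [Nat.card_congr e, Nat.card_eq_fintype_card, Fintype.card_coe]

/-! ### Boxes -/

/-- The box of the label `x` consists of the descendants of `x` up to height `r` above `x` and of
the ancestors of `x` up to depth `s` below `x`. -/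
def boxLabels (x : List ℕ) (r s : ℕ) : Set (List ℕ) :=
  {v | (x <:+ v ∧ v.length ≤ x.length + r) ∨ (v <:+ x ∧ x.length ≤ v.length + s)}

theorem mem_boxLabels_of_suffix {x u v w : List ℕ} {r s : ℕ} (hu : u ∈ boxLabels x r s)
    (hv : v ∈ boxLabels x r s) (hvw : v <:+ w) (hwu : w <:+ u) : w ∈ boxLabels x r s := by
  have h1 := hvw.length_le
  have h2 := hwu.length_le
  rcases hu with ⟨hu, hu'⟩ | ⟨hu, hu'⟩
  · rcases List.suffix_or_suffix_of_suffix hu hwu with h | h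
    · exact Or.inl ⟨h, by omega⟩
    · refine Or.inr ⟨h, ?_⟩
      rcases hv with ⟨hv, hv'⟩ | ⟨hv, hv'⟩
      · have := hv.length_le; omega
      · omega
  · refine Or.inr ⟨hwu.trans hu, ?_⟩
    rcases hv with ⟨hv, hv'⟩ | ⟨hv, hv'⟩
    · have := hv.length_le; omega
    · omega

/-- The subgraph of the truncated tree induced by the box of the label `x`. -/
def boxSubgraph (k : List ℕ → ℕ) (n : ℕ) (x : List ℕ) (r s : ℕ) :
    (truncGraph (familyTree k) (treeRoot k) n).Subgraph :=
  (⊤ : (truncGraph (familyTree k) (treeRoot k) n).Subgraph).induce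
    {v | v.1.1 ∈ boxLabels x r s}

theorem edist_boxSubgraph_of_suffix {k : List ℕ → ℕ} {n : ℕ} {x : List ℕ} {r s : ℕ}
    (u v : (boxSubgraph k n x r s).verts) (h : v.1.1.1 <:+ u.1.1.1) :
    (boxSubgraph k n x r s).coe.edist u v + v.1.1.1.length ≤ u.1.1.1.length := by
  refine edist_add_length_le_of_suffix (f := fun u : (boxSubgraph k n x r s).verts => u.1.1.1)
    ((Subtype.val_injective.comp Subtype.val_injective).comp Subtype.val_injective) ?_ h ?_
  · intro y z i hyz
    exact ⟨y.2, z.2, Or.inr ⟨i, hyz⟩⟩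
  · intro w hvw hwu
    have hw : w ∈ boxLabels x r s := mem_boxLabels_of_suffix u.2 v.2 hvw hwu
    exact ⟨⟨TruncVertex.mk w (u.1.1.2.of_suffix hwu)
      (hwu.length_le.trans (length_truncVertex_le u.1)), hw⟩, rfl⟩

theorem isBox_boxSubgraph {k : List ℕ → ℕ} {n : ℕ} {x : List ℕ} {r s ℓ : ℕ}
    (hx : IsLabel k x) (hn : x.length ≤ n) (hrs : r + s + 1 ≤ ℓ) (hr : 2 * r + 1 ≤ ℓ) :
    IsBox ℓ (boxSubgraph k n x r s) := by
  have key (u v : (boxSubgraph k n x r s).verts) (h : v.1.1.1 <:+ u.1.1.1) :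
      (boxSubgraph k n x r s).coe.edist u v + 1 ≤ (ℓ : ℕ∞) := by
    have h1 := edist_boxSubgraph_of_suffix u v h
    have hu : u.1.1.1.length ≤ x.length + r := by
      rcases u.2 with h | h
      · exact h.2
      · exact h.1.length_le.trans (by omega)
    have hv : x.length ≤ v.1.1.1.length + s := by
      rcases v.2 with h | h
      · exact h.1.length_le.trans (by omega)
      · exact h.2
    generalize (boxSubgraph k n x r s).coe.edist u v = d at h1
    cases d using ENat.recTopCoe with
    | top => simp at h1
    | coe d => norm_cast at h1 ⊢; omega
  intro u v
  by_cases huv : v.1.1.1 <:+ u.1.1.1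
  · exact key u v huv
  by_cases hvu : u.1.1.1 <:+ v.1.1.1
  · rw [SimpleGraph.edist_comm]
    exact key v u hvu
  -- An ancestor of `x` is comparable with every vertex of the box, so two incomparable vertices
  -- both descend from `x`, and the path through `x` has length at most 2r.
  have hu : x <:+ u.1.1.1 ∧ u.1.1.1.length ≤ x.length + r := by
    rcases u.2 with h | h
    · exact h
    · exfalso
      rcases v.2 with h' | h'
      · exact hvu (h.1.trans h'.1)
      · exact (List.suffix_or_suffix_of_suffix h.1 h'.1).elim hvu huv
  have hv : x <:+ v.1.1.1 ∧ v.1.1.1.length ≤ x.length + r := by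
    rcases v.2 with h | h
    · exact h
    · exact absurd (h.1.trans hu.1) huv
  have hxm : x ∈ boxLabels x r s := Or.inl ⟨List.suffix_rfl, by omega⟩
  let y : (boxSubgraph k n x r s).verts := ⟨TruncVertex.mk x hx hn, hxm⟩
  have h1 := edist_boxSubgraph_of_suffix u y hu.1
  have h2 := edist_boxSubgraph_of_suffix v y hv.1
  have h3 := (boxSubgraph k n x r s).coe.edist_triangle (u := u) (v := y) (w := v)
  rw [SimpleGraph.edist_comm (u := y)] at h3
  have hy : y.1.1.1 = x := rfl
  rw [hy] at h1 h2
  refine (add_le_add_left h3 1).trans ?_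
  generalize (boxSubgraph k n x r s).coe.edist u y = d at h1
  generalize (boxSubgraph k n x r s).coe.edist v y = e at h2
  cases d using ENat.recTopCoe with
  | top => simp at h1
  | coe d =>
    cases e using ENat.recTopCoe with
    | top => simp at h2
    | coe e => norm_cast at h1 h2 ⊢; omega

/-! ### The box number of the truncated tree -/

/-- The indices `j` for which generation `n - (r + ℓ * j)` holds centers of an optimal box cover. -/
def centerLevels (n ℓ r : ℕ) : Finset ℕ := (Finset.range (n + 1)).filter fun j => r + ℓ * j ≤ n

/-- The centers of an optimal box cover of the truncated tree. -/
def centerLabels (k : List ℕ → ℕ) (n ℓ r : ℕ) : Finset (List ℕ) :=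
  (centerLevels n ℓ r).biUnion fun j => levelLabels k (n - (r + ℓ * j))

theorem card_centerLabels (k : List ℕ → ℕ) {n ℓ r : ℕ} (hℓ : 1 ≤ ℓ) :
    (centerLabels k n ℓ r).card =
      ∑ j ∈ centerLevels n ℓ r, (levelLabels k (n - (r + ℓ * j))).card := by
  refine Finset.card_biUnion fun i hi j hj hij => disjoint_levelLabels fun h => hij ?_
  simp only [centerLevels, Finset.coe_filter, Set.mem_ofPred_eq] at hi hj
  exact Nat.eq_of_mul_eq_mul_left hℓ (by omega)

theorem mem_centerLabels {k : List ℕ → ℕ} {n ℓ r : ℕ} (hℓ : 1 ≤ ℓ) {x : List ℕ} :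
    x ∈ centerLabels k n ℓ r ↔ IsLabel k x ∧ ∃ j, x.length + r + ℓ * j = n := by
  simp only [centerLabels, centerLevels, Finset.mem_biUnion, Finset.mem_filter, Finset.mem_range,
    mem_levelLabels]
  constructor
  · rintro ⟨j, ⟨-, hj⟩, hx, hl⟩
    exact ⟨hx, j, by omega⟩
  · rintro ⟨hx, j, hj⟩
    have : j ≤ ℓ * j := Nat.le_mul_of_pos_left j hℓ
    exact ⟨j, ⟨by omega, by omega⟩, hx, by omega⟩

theorem exists_center_of_length_le {k : List ℕ → ℕ} (hk : ∀ u, 1 ≤ k u) {n ℓ r s : ℕ}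
    (hrs : r + s + 1 = ℓ) {v : List ℕ} (hv : IsLabel k v) (hn : v.length ≤ n) :
    ∃ x ∈ insert [] (centerLabels k n ℓ r), v ∈ boxLabels x r s := by
  have hℓ : 1 ≤ ℓ := by omega
  -- With this `j`, the generation of `v` lies between n - ℓj - (ℓ-1) and n - ℓj, that is, from s
  -- below to r above the center generation n - r - ℓj. The center is an ancestor of `v`, or a
  -- descendant through first children. If no such generation exists, `v` has height less than r and
  -- the root box contains it.
  set j := (n - v.length) / ℓ
  have hj1 : ℓ * j ≤ n - v.length := Nat.mul_div_le _ _
  have hj2 : n - v.length < ℓ * j + ℓ := Nat.lt_mul_div_succ _ hℓ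
  by_cases h : r + ℓ * j ≤ n
  · by_cases hg : n - (r + ℓ * j) ≤ v.length
    · have hsuf := List.drop_suffix (v.length - (n - (r + ℓ * j))) v
      refine ⟨_, Finset.mem_insert_of_mem ((mem_centerLabels hℓ).2
        ⟨hv.of_suffix hsuf, j, ?_⟩), Or.inl ⟨hsuf, ?_⟩⟩ <;>
      · rw [List.length_drop]; omega
    · refine ⟨_, Finset.mem_insert_of_mem ((mem_centerLabels hℓ).2
        ⟨isLabel_replicate_zero_append hk hv (n - (r + ℓ * j) - v.length), j, ?_⟩),
        Or.inr ⟨List.suffix_append _ _, ?_⟩⟩ <;>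
      · rw [List.length_append, List.length_replicate]; omega
  · exact ⟨[], Finset.mem_insert_self _ _, Or.inl ⟨List.nil_suffix, by simp; omega⟩⟩

theorem exists_boxCover {k : List ℕ → ℕ} (hk : ∀ u, 1 ≤ k u) {n ℓ r s : ℕ}
    (hrs : r + s + 1 = ℓ) (hr : 2 * r + 1 ≤ ℓ) :
    ∃ S : Finset (truncGraph (familyTree k) (treeRoot k) n).Subgraph,
      S.card ≤ (centerLabels k n ℓ r).card + 1 ∧ (∀ H ∈ S, IsBox ℓ H) ∧
        ∀ v, ∃ H ∈ S, v ∈ H.verts := by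
  classical
  refine ⟨(insert [] (centerLabels k n ℓ r)).image fun x => boxSubgraph k n x r s,
    Finset.card_image_le.trans (Finset.card_insert_le _ _), ?_, ?_⟩
  · intro H hH
    obtain ⟨x, hx, rfl⟩ := Finset.mem_image.1 hH
    rcases Finset.mem_insert.1 hx with rfl | hx
    · exact isBox_boxSubgraph trivial (Nat.zero_le _) hrs.le hr
    · obtain ⟨hx, j, hj⟩ := (mem_centerLabels (by omega)).1 hx
      exact isBox_boxSubgraph hx (by omega) hrs.le hr
  · intro v
    obtain ⟨x, hx, hv⟩ := exists_center_of_length_le hk hrs v.1.2 (length_truncVertex_le v)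
    exact ⟨_, Finset.mem_image_of_mem _ hx, hv⟩

theorem boxNumber_le_card_centerLabels_add_one {k : List ℕ → ℕ} (hk : ∀ u, 1 ≤ k u)
    {n ℓ r s : ℕ} (hrs : r + s + 1 = ℓ) (hr : 2 * r + 1 ≤ ℓ) :
    boxNumber (truncGraph (familyTree k) (treeRoot k) n) ℓ ≤
      (centerLabels k n ℓ r).card + 1 := by
  obtain ⟨S, hS, hbox, hcov⟩ := exists_boxCover (n := n) hk hrs hr
  have h : boxNumber (truncGraph (familyTree k) (treeRoot k) n) ℓ ≤ S.card :=
    Nat.sInf_le ⟨S, rfl, hbox, hcov⟩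
  exact h.trans hS

theorem IsBox.exists_common_suffix {k : List ℕ → ℕ} {n ℓ : ℕ}
    {H : (truncGraph (familyTree k) (treeRoot k) n).Subgraph} (hH : IsBox ℓ H)
    {u v : TruncVertex k n} (hu : u ∈ H.verts) (hv : v ∈ H.verts) :
    ∃ w, w <:+ u.1.1 ∧ w <:+ v.1.1 ∧
      u.1.1.length + v.1.1.length + 1 ≤ ℓ + 2 * w.length := by
  have h := hH ⟨u, hu⟩ ⟨v, hv⟩
  have htop : H.coe.edist ⟨u, hu⟩ ⟨v, hv⟩ ≠ ⊤ := fun h' => by simp [h'] at h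
  obtain ⟨p, hp⟩ := SimpleGraph.exists_walk_of_edist_ne_top htop
  let f : H.coe →g familyTree k :=
    { toFun := fun x => x.1.1
      map_rel' := fun {a b} hab => H.adj_sub hab }
  obtain ⟨w, hwu, hwv, hw⟩ := exists_common_suffix_of_walk (p.map f)
  refine ⟨w, hwu, hwv, ?_⟩
  rw [← hp] at h
  norm_cast at h
  rw [SimpleGraph.Walk.length_map] at hw
  change u.1.1.length + v.1.1.length ≤ _ at hw
  omega

/-- Different center generations are at least ℓ apart, too far for one box. Within one generation,
distinct centers would force a distance of at least 2r + 2 ≥ ℓ. -/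
theorem eq_of_common_suffix {x y w : List ℕ} {n ℓ r i j : ℕ} (hr : ℓ ≤ 2 * r + 2)
    (hx : x.length + r + ℓ * i = n) (hy : y.length + r + ℓ * j = n)
    (hwx : w <:+ List.replicate r 0 ++ x) (hwy : w <:+ List.replicate r 0 ++ y)
    (hw : (List.replicate r 0 ++ x).length + (List.replicate r 0 ++ y).length + 1 ≤
      ℓ + 2 * w.length) : x = y := by
  have h1 := hwx.length_le
  have h2 := hwy.length_le
  simp only [List.length_append, List.length_replicate] at hw h1 h2
  have hij : i = j := by
    rcases lt_trichotomy i j with h | h | h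
    · have := Nat.mul_le_mul_left ℓ (Nat.succ_le_of_lt h)
      rw [Nat.mul_succ] at this
      omega
    · exact h
    · have := Nat.mul_le_mul_left ℓ (Nat.succ_le_of_lt h)
      rw [Nat.mul_succ] at this
      omega
  subst hij
  have hxw : x <:+ w := List.suffix_of_suffix_length_le (List.suffix_append _ _) hwx (by omega)
  have hyw : y <:+ w := List.suffix_of_suffix_length_le (List.suffix_append _ _) hwy (by omega)
  exact (List.suffix_of_suffix_length_le hxw hyw (by omega)).eq_of_length (by omega)

theorem card_centerLabels_le_boxNumber {k : List ℕ → ℕ} (hk : ∀ u, 1 ≤ k u)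
    {n ℓ r s : ℕ} (hrs : r + s + 1 = ℓ) (hr : 2 * r + 1 ≤ ℓ) (hr' : ℓ ≤ 2 * r + 2) :
    (centerLabels k n ℓ r).card ≤ boxNumber (truncGraph (familyTree k) (treeRoot k) n) ℓ := by
  -- Some cover must exist, since `sInf ∅ = 0` would break the lower bound.
  obtain ⟨S₀, -, hbox₀, hcov₀⟩ := exists_boxCover (n := n) hk hrs hr
  refine le_csInf ⟨_, S₀, rfl, hbox₀, hcov₀⟩ ?_
  rintro m ⟨S, rfl, hbox, hcov⟩
  have hℓ : 1 ≤ ℓ := by omega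
  have hex (x : List ℕ) (hx : x ∈ centerLabels k n ℓ r) :
      ∃ H ∈ S, ∃ v ∈ H.verts, v.1.1 = List.replicate r 0 ++ x := by
    obtain ⟨hx, j, hj⟩ := (mem_centerLabels hℓ).1 hx
    obtain ⟨H, hH, hv⟩ := hcov (TruncVertex.mk (List.replicate r 0 ++ x)
      (isLabel_replicate_zero_append hk hx r) (by simp; omega))
    exact ⟨H, hH, _, hv, rfl⟩
  choose! F hF v hv hvx using hex
  refine Finset.card_le_card_of_injOn F hF ?_
  intro x hx y hy hxy
  obtain ⟨-, i, hi⟩ := (mem_centerLabels hℓ).1 hx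
  obtain ⟨-, j, hj⟩ := (mem_centerLabels hℓ).1 hy
  obtain ⟨w, hwx, hwy, hw⟩ :=
    (hbox _ (hF x hx)).exists_common_suffix (hv x hx) (hxy ▸ hv y hy)
  rw [hvx x hx] at hwx hw
  rw [hvx y hy] at hwy hw
  exact eq_of_common_suffix hr' hi hj hwx hwy hw

/-! ### Offspring numbers in breadth-first order -/

section BreadthFirst

variable {Ω : Type*} {ξ : List ℕ → Ω → ℕ}

/-- The number of children of the `j`-th vertex in breadth-first order. -/
def bfsOffspring (ξ : List ℕ → Ω → ℕ) (j : ℕ) (ω : Ω) : ℕ :=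
  ξ (bfsVertex (fun u => ξ u ω) j) ω

theorem bfsVertex_eq_of_bfsOffspring_eq {ω ω₀ : Ω} {j : ℕ}
    (h : ∀ i < j, ξ (bfsVertex (fun u => ξ u ω₀) i) ω = bfsOffspring ξ i ω₀) :
    ∀ i ≤ j, bfsVertex (fun u => ξ u ω) i = bfsVertex (fun u => ξ u ω₀) i :=
  fun _ hi => (bfsVertex_congr fun l hl => (h l (hl.trans_le hi)).symm).symm

theorem bfsVertex_eq_of_bfsOffspring_eq' {ω ω₀ : Ω} {j : ℕ}
    (h : ∀ i < j, bfsOffspring ξ i ω = bfsOffspring ξ i ω₀) :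
    ∀ i ≤ j, bfsVertex (fun u => ξ u ω) i = bfsVertex (fun u => ξ u ω₀) i := by
  intro i
  induction i using Nat.strong_induction_on with
  | _ i ih =>
    intro hi
    refine bfsVertex_congr fun l hl => ?_
    have hv := ih l hl (hl.le.trans hi)
    have := h l (hl.trans_le hi)
    simp only [bfsOffspring] at this
    rw [this, hv]

/-- The values a_0, …, a_{m-1} already determine the first m + 1 explored labels, so the random
labels may be replaced by those of one sample `ω₀` with this history. -/
theorem forall_bfsOffspring_eq_iff {ω ω₀ : Ω} {a : ℕ → ℕ} {m : ℕ}
    (h₀ : ∀ i < m, bfsOffspring ξ i ω₀ = a i) :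
    (∀ i < m + 1, bfsOffspring ξ i ω = a i) ↔
      ∀ i < m + 1, ξ (bfsVertex (fun u => ξ u ω₀) i) ω = a i := by
  constructor
  · intro h i hi
    have := bfsVertex_eq_of_bfsOffspring_eq' (ξ := ξ) (ω := ω) (ω₀ := ω₀) (j := m)
      (fun l hl => (h l (by omega)).trans (h₀ l hl).symm) i (by omega)
    rw [← this]
    exact h i hi
  · intro h i hi
    have := bfsVertex_eq_of_bfsOffspring_eq (ξ := ξ) (ω := ω) (ω₀ := ω₀) (j := m)
      (fun l hl => (h l (by omega)).trans (h₀ l hl).symm) i (by omega)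
    rw [bfsOffspring, this]
    exact h i hi

variable [MeasurableSpace Ω] {P : Measure Ω}

theorem measurable_bfsOffspring (hmeas : ∀ u, Measurable (ξ u)) (j : ℕ) :
    Measurable (bfsOffspring ξ j) := by
  let _ : MeasurableSpace (List (List ℕ)) := ⊤
  have : DiscreteMeasurableSpace (List (List ℕ)) := ⟨fun _ => trivial⟩
  -- Queues form a countable type, so evaluating `ξ` at a random label is measurable queue by queue.
  have step {α : Type} [MeasurableSpace α] (F : List (List ℕ) → ℕ → α)
      (hF : ∀ L, Measurable (F L)) {Q : Ω → List (List ℕ)} (hQ : Measurable Q) (i : ℕ) :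
      Measurable fun ω => F (Q ω) (ξ ((Q ω).getD i []) ω) :=
    (measurable_from_prod_countable_right (f := fun p : List (List ℕ) × Ω =>
      F p.1 (ξ (p.1.getD i []) p.2)) fun L => (hF L).comp (hmeas (L.getD i []))).comp
        (hQ.prodMk measurable_id)
  have hQ : ∀ j, Measurable fun ω => bfsQueue (fun u => ξ u ω) j := by
    intro j
    induction j with
    | zero => exact measurable_const
    | succ j ih =>
      exact step (fun L c => L ++ (List.range c).map (· :: L.getD j []))
        (fun _ => measurable_from_top) ih j
  exact step (fun _ c => c) (fun _ => measurable_id) (hQ j) j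

theorem measurable_bfsOffspring_fin (hmeas : ∀ u, Measurable (ξ u)) (m : ℕ) :
    Measurable fun ω (i : Fin m) => bfsOffspring ξ i ω :=
  measurable_pi_lambda _ fun i => measurable_bfsOffspring hmeas i

variable [IsProbabilityMeasure P] {ν : Measure ℕ}

theorem measure_forall_bfsOffspring_eq (hmeas : ∀ u, Measurable (ξ u)) (hindep : iIndepFun ξ P)
    (hlaw : ∀ u, P.map (ξ u) = ν) (hpos : ∀ u ω, 1 ≤ ξ u ω) (a : ℕ → ℕ) (m : ℕ) :
    P {ω | ∀ i < m, bfsOffspring ξ i ω = a i} = ∏ i ∈ Finset.range m, ν {a i} := by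
  induction m with
  | zero => simp
  | succ m ih =>
    -- If the history is realised, the event concerns distinct fixed labels and independence gives
    -- the product. Otherwise both sides vanish.
    by_cases h : ∃ ω₀, ∀ i < m, bfsOffspring ξ i ω₀ = a i
    · obtain ⟨ω₀, h₀⟩ := h
      have hinj := injective_bfsVertex (k := fun u => ξ u ω₀) fun u => hpos u ω₀
      have hi := (hindep.precomp hinj).measure_inter_preimage_eq_mul (Finset.range (m + 1))
        (sets := fun i => {a i}) fun _ _ => measurableSet_singleton _
      have hset : {ω | ∀ i < m + 1, bfsOffspring ξ i ω = a i} =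
          ⋂ i ∈ Finset.range (m + 1), ξ (bfsVertex (fun u => ξ u ω₀) i) ⁻¹' {a i} := by
        ext ω
        rw [Set.mem_ofPred_eq, forall_bfsOffspring_eq_iff h₀]
        simp
      rw [hset, hi]
      refine Finset.prod_congr rfl fun i _ => ?_
      rw [← hlaw, Measure.map_apply (hmeas _) (measurableSet_singleton _)]
    · have h0 : P {ω | ∀ i < m, bfsOffspring ξ i ω = a i} = 0 := by
        rw [show {ω | ∀ i < m, bfsOffspring ξ i ω = a i} = ∅ from
          Set.eq_empty_of_forall_notMem fun ω hω => h ⟨ω, hω⟩, measure_empty]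
      rw [Finset.prod_range_succ, ← ih, h0, zero_mul]
      exact measure_mono_null (Set.ofPred_subset_ofPred.2 fun ω hω i hi => hω i (by omega)) h0

theorem map_bfsOffspring_fin (hmeas : ∀ u, Measurable (ξ u)) (hindep : iIndepFun ξ P)
    (hlaw : ∀ u, P.map (ξ u) = ν) [IsProbabilityMeasure ν] (hpos : ∀ u ω, 1 ≤ ξ u ω) (m : ℕ) :
    P.map (fun ω (i : Fin m) => bfsOffspring ξ i ω) = Measure.pi fun _ : Fin m => ν := by
  refine Measure.ext_of_singleton fun a => ?_
  rw [Measure.map_apply (measurable_bfsOffspring_fin hmeas _) (measurableSet_singleton _),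
    Measure.pi_singleton]
  let b : ℕ → ℕ := fun i => if h : i < m then a ⟨i, h⟩ else 0
  have hb (i : Fin m) : a i = b i := by simp [b]
  have := measure_forall_bfsOffspring_eq hmeas hindep hlaw hpos b m
  rw [Finset.prod_range] at this
  simp only [hb, ← this]
  congr 1
  ext ω
  simp [funext_iff, Fin.forall_iff, hb]

theorem map_bfsOffspring (hmeas : ∀ u, Measurable (ξ u)) (hindep : iIndepFun ξ P)
    (hlaw : ∀ u, P.map (ξ u) = ν) [IsProbabilityMeasure ν] (hpos : ∀ u ω, 1 ≤ ξ u ω) (j : ℕ) :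
    P.map (bfsOffspring ξ j) = ν := by
  have h := (measurePreserving_eval (fun _ : Fin (j + 1) => ν) (Fin.last j)).map_eq
  rw [← map_bfsOffspring_fin hmeas hindep hlaw hpos (j + 1), Measure.map_map
    (measurable_pi_apply _) (measurable_bfsOffspring_fin hmeas _)] at h
  exact h

theorem indepFun_bfsOffspring (hmeas : ∀ u, Measurable (ξ u)) (hindep : iIndepFun ξ P)
    (hlaw : ∀ u, P.map (ξ u) = ν) [IsProbabilityMeasure ν] (hpos : ∀ u ω, 1 ≤ ξ u ω) {i j : ℕ}
    (hij : i ≠ j) : IndepFun (bfsOffspring ξ i) (bfsOffspring ξ j) P := by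
  have hm := measurable_bfsOffspring hmeas
  have h : iIndepFun (fun l : Fin (max i j + 1) => bfsOffspring ξ l) P := by
    rw [iIndepFun_iff_map_fun_eq_pi_map fun l : Fin _ => (hm l).aemeasurable,
      map_bfsOffspring_fin hmeas hindep hlaw hpos]
    simp only [map_bfsOffspring hmeas hindep hlaw hpos]
  exact h.indepFun (i := ⟨i, by omega⟩) (j := ⟨j, by omega⟩) fun h' => hij (Fin.mk.inj h')

theorem tendsto_average_bfsOffspring (hmeas : ∀ u, Measurable (ξ u)) (hindep : iIndepFun ξ P)
    (hlaw : ∀ u, P.map (ξ u) = ν) [IsProbabilityMeasure ν] (hpos : ∀ u ω, 1 ≤ ξ u ω)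
    (hint : Integrable (fun i : ℕ => (i : ℝ)) ν) :
    ∀ᵐ ω ∂P, Tendsto (fun n : ℕ => (∑ i ∈ Finset.range n, (bfsOffspring ξ i ω : ℝ)) / n) atTop
      (𝓝 (∫ i, (i : ℝ) ∂ν)) := by
  have hm := measurable_bfsOffspring hmeas
  have hcast : Measurable fun i : ℕ => (i : ℝ) := measurable_from_top
  have hmap := map_bfsOffspring hmeas hindep hlaw hpos
  have hint0 : ∫ ω, (bfsOffspring ξ 0 ω : ℝ) ∂P = ∫ i, (i : ℝ) ∂ν := by
    rw [← hmap 0, integral_map (hm 0).aemeasurable hcast.aestronglyMeasurable]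
  rw [← hint0]
  -- Pairwise independence suffices for this form of the strong law.
  refine strong_law_ae_real (fun i ω => (bfsOffspring ξ i ω : ℝ)) ?_ ?_ ?_
  · rw [← hmap 0] at hint
    exact hint.comp_measurable (hm 0)
  · exact fun i j hij => (indepFun_bfsOffspring hmeas hindep hlaw hpos hij).comp hcast hcast
  · intro i
    exact (IdentDistrib.mk (hm i).aemeasurable (hm 0).aemeasurable
      ((hmap i).trans (hmap 0).symm)).comp hcast

/-- The number of vertices up to generation `n` grows by the factor `∫ i, i ∂ν` asymptotically. -/
theorem tendsto_card_ballLabels_ratio (hmeas : ∀ u, Measurable (ξ u)) (hindep : iIndepFun ξ P)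
    (hlaw : ∀ u, P.map (ξ u) = ν) [IsProbabilityMeasure ν] (hpos : ∀ u ω, 1 ≤ ξ u ω)
    (hint : Integrable (fun i : ℕ => (i : ℝ)) ν) :
    ∀ᵐ ω ∂P, Tendsto (fun n : ℕ => ((ballLabels (fun u => ξ u ω) (n + 1)).card : ℝ) /
      (ballLabels (fun u => ξ u ω) n).card) atTop (𝓝 (∫ i, (i : ℝ) ∂ν)) := by
  filter_upwards [tendsto_average_bfsOffspring hmeas hindep hlaw hpos hint] with ω hω
  have hk : ∀ u, 1 ≤ ξ u ω := fun u => hpos u ω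
  have hS : Tendsto (fun n => (ballLabels (fun u => ξ u ω) n).card) atTop atTop :=
    tendsto_atTop_mono (fun n => (lt_card_ballLabels hk n).le) tendsto_id
  have h1 : Tendsto (fun n => 1 / ((ballLabels (fun u => ξ u ω) n).card : ℝ)) atTop (𝓝 0) :=
    tendsto_one_div_atTop_nhds_zero_nat.comp hS
  have h2 := h1.add (hω.comp hS)
  rw [zero_add] at h2
  refine h2.congr fun n => ?_
  rw [card_ballLabels_succ_eq_sum hk]
  push_cast
  simp only [Function.comp_apply, bfsOffspring]
  rw [add_div]

end BreadthFirst

/-! ### Asymptotics -/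

theorem exists_uniform_bound_lt_one {x : ℕ → ℝ} {c : ℝ} (hx : ∀ n, x n < 1)
    (hlim : Tendsto x atTop (𝓝 c)) (hc : c < 1) : ∃ θ, 0 ≤ θ ∧ θ < 1 ∧ ∀ n, x n ≤ θ := by
  obtain ⟨d, hcd, hd⟩ := exists_between hc
  obtain ⟨N, hN⟩ := eventually_atTop.1 (hlim.eventually_le_const hcd)
  have hfin (M : ℕ) : ∃ θ, 0 ≤ θ ∧ θ < 1 ∧ ∀ n < M, x n ≤ θ := by
    induction M with
    | zero => exact ⟨0, le_rfl, zero_lt_one, by simp⟩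
    | succ M ih =>
      obtain ⟨θ, h0, h1, h⟩ := ih
      refine ⟨max θ (x M), le_max_of_le_left h0, max_lt h1 (hx M), fun n hn => ?_⟩
      rcases Nat.lt_succ_iff_lt_or_eq.1 hn with hn | rfl
      · exact (h n hn).trans (le_max_left _ _)
      · exact le_max_right _ _
  obtain ⟨θ, h0, h1, h⟩ := hfin N
  refine ⟨max θ d, le_max_of_le_left h0, max_lt h1 hd, fun n => ?_⟩
  rcases lt_or_ge n N with hn | hn
  · exact (h n hn).trans (le_max_left _ _)
  · exact (hN n hn).trans (le_max_right _ _)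

section Asymptotics

variable {S Z : ℕ → ℝ} {μ : ℝ}

theorem tendsto_div_add (hS : ∀ n, 0 < S n)
    (hlim : Tendsto (fun n => S n / S (n + 1)) atTop (𝓝 μ⁻¹)) (i : ℕ) :
    Tendsto (fun n => S n / S (n + i)) atTop (𝓝 (μ⁻¹ ^ i)) := by
  induction i with
  | zero => simp [div_self (hS _).ne']
  | succ i ih =>
    rw [pow_succ]
    refine (ih.mul (hlim.comp (tendsto_add_atTop_nat i))).congr fun n => ?_
    simp only [Function.comp_apply, add_assoc]
    exact div_mul_div_cancel₀ (hS _).ne'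

theorem tendsto_increment_div (hS : ∀ n, 0 < S n) (hSZ : ∀ n, S (n + 1) = S n + Z (n + 1))
    (hlim : Tendsto (fun n => S n / S (n + 1)) atTop (𝓝 μ⁻¹)) (i : ℕ) :
    Tendsto (fun n => Z (n - i) / S n) atTop (𝓝 ((1 - μ⁻¹) * μ⁻¹ ^ i)) := by
  -- The shift removes truncated subtraction and makes the generation index a successor, where `hSZ`
  -- applies.
  rw [← tendsto_add_atTop_iff_nat (i + 1)]
  have h1 : Tendsto (fun n => 1 - S n / S (n + 1)) atTop (𝓝 (1 - μ⁻¹)) := hlim.const_sub 1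
  have h2 := (tendsto_div_add hS hlim i).comp (tendsto_add_atTop_nat 1)
  refine (h1.mul h2).congr fun n => ?_
  have ha := (hS (n + 1)).ne'
  rw [show n + (i + 1) - i = n + 1 by omega, show n + (i + 1) = n + 1 + i by omega]
  have hb := (hS (n + 1 + i)).ne'
  simp only [Function.comp_apply]
  field_simp
  rw [hSZ]
  ring

theorem le_pow_mul_of_le_mul {θ : ℝ} (h0 : 0 ≤ θ) (h : ∀ n, S n ≤ θ * S (n + 1)) (n i : ℕ) :
    S n ≤ θ ^ i * S (n + i) := by
  induction i with
  | zero => simp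
  | succ i ih =>
    calc S n ≤ θ ^ i * S (n + i) := ih
      _ ≤ θ ^ i * (θ * S (n + i + 1)) := by gcongr; exact h _
      _ = θ ^ (i + 1) * S (n + (i + 1)) := by rw [← add_assoc]; ring

theorem tendsto_sum_centerLevels_div (hS : ∀ n, 0 < S n) (hZ : ∀ n, 0 < Z n)
    (hZS : ∀ n, Z n ≤ S n) (hSZ : ∀ n, S (n + 1) = S n + Z (n + 1)) (hμ : 1 < μ)
    (hlim : Tendsto (fun n => S n / S (n + 1)) atTop (𝓝 μ⁻¹)) {ℓ r : ℕ} (hℓ : 1 ≤ ℓ) :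
    Tendsto (fun n => (∑ j ∈ centerLevels n ℓ r, Z (n - (r + ℓ * j))) / S n) atTop
      (𝓝 ((1 - μ⁻¹) * μ⁻¹ ^ r / (1 - μ⁻¹ ^ ℓ))) := by
  have hμ1 : μ⁻¹ < 1 := inv_lt_one_of_one_lt₀ hμ
  have hμ0 : 0 ≤ μ⁻¹ := by positivity
  -- A single ratio θ < 1 valid for all n gives Z_{n-i} ≤ S_{n-i} ≤ θ^i S_n, the geometric
  -- domination needed to exchange limit and sum.
  obtain ⟨θ, hθ0, hθ1, hθ⟩ := exists_uniform_bound_lt_one (fun n => by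
    rw [div_lt_one (hS _), hSZ]; linarith [hZ (n + 1)]) hlim hμ1
  have hθ' (n : ℕ) : S n ≤ θ * S (n + 1) := (div_le_iff₀ (hS _)).1 (hθ n)
  let f : ℕ → ℕ → ℝ := fun n j => if r + ℓ * j ≤ n then Z (n - (r + ℓ * j)) / S n else 0
  have hf (n : ℕ) : ∑' j, f n j = (∑ j ∈ centerLevels n ℓ r, Z (n - (r + ℓ * j))) / S n := by
    rw [tsum_eq_sum (s := centerLevels n ℓ r), Finset.sum_div]
    · refine Finset.sum_congr rfl fun j hj => if_pos (Finset.mem_filter.1 hj).2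
    · intro j hj
      refine if_neg fun h => hj (Finset.mem_filter.2 ⟨Finset.mem_range.2 ?_, h⟩)
      have : j ≤ ℓ * j := Nat.le_mul_of_pos_left j hℓ
      omega
  have hg : ∑' j : ℕ, (1 - μ⁻¹) * μ⁻¹ ^ (r + ℓ * j) =
      (1 - μ⁻¹) * μ⁻¹ ^ r / (1 - μ⁻¹ ^ ℓ) := by
    simp_rw [pow_add, pow_mul, ← mul_assoc]
    rw [tsum_mul_left, tsum_geometric_of_lt_one (by positivity)
      (pow_lt_one₀ hμ0 hμ1 (by omega)), div_eq_mul_inv]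
  rw [← hg]
  simp_rw [← hf]
  refine tendsto_tsum_of_dominated_convergence (bound := fun j => θ ^ j)
    (summable_geometric_of_lt_one hθ0 hθ1) (fun j => ?_) (Eventually.of_forall fun n j => ?_)
  · refine (tendsto_increment_div hS hSZ hlim (r + ℓ * j)).congr' ?_
    filter_upwards [eventually_ge_atTop (r + ℓ * j)] with n hn
    exact (if_pos hn).symm
  · by_cases h : r + ℓ * j ≤ n
    · have hb := le_pow_mul_of_le_mul hθ0 hθ' (n - (r + ℓ * j)) (r + ℓ * j)
      rw [Nat.sub_add_cancel h] at hb
      have hj : j ≤ r + ℓ * j := (Nat.le_mul_of_pos_left j hℓ).trans (Nat.le_add_left _ _)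
      simp only [f, if_pos h]
      rw [Real.norm_of_nonneg (div_nonneg (hZ _).le (hS _).le), div_le_iff₀ (hS n)]
      calc Z (n - (r + ℓ * j)) ≤ θ ^ (r + ℓ * j) * S n := (hZS _).trans hb
        _ ≤ θ ^ j * S n := mul_le_mul_of_nonneg_right
          (pow_le_pow_of_le_one hθ0 hθ1.le hj) (hS n).le
    · simp only [f, if_neg h, norm_zero]
      positivity

end Asymptotics

/-- Only μ^{-r} decays exponentially, with r/ℓ → 1/2; the other factors have bounded logarithms. -/
theorem tendsto_log_boxDensity_div {μ : ℝ} (hμ : 1 < μ) :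
    Tendsto (fun ℓ : ℕ =>
      Real.log ((1 - μ⁻¹) * μ⁻¹ ^ ((ℓ - 1) / 2) / (1 - μ⁻¹ ^ ℓ)) / (-(ℓ : ℝ))) atTop
      (𝓝 (Real.log μ / 2)) := by
  have hμ1 : μ⁻¹ < 1 := inv_lt_one_of_one_lt₀ hμ
  have hμ0 : 0 < μ⁻¹ := by positivity
  have hinv : Tendsto (fun ℓ : ℕ => (ℓ : ℝ)⁻¹) atTop (𝓝 0) := tendsto_inv_atTop_nhds_zero_nat
  have hhalf : Tendsto (fun ℓ : ℕ => (((ℓ - 1) / 2 : ℕ) : ℝ) * (ℓ : ℝ)⁻¹) atTop (𝓝 (1 / 2)) := by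
    have hlow : Tendsto (fun ℓ : ℕ => (1 / 2 : ℝ) - (ℓ : ℝ)⁻¹) atTop (𝓝 (1 / 2)) := by
      simpa using hinv.const_sub (1 / 2 : ℝ)
    refine tendsto_of_tendsto_of_tendsto_of_le_of_le' hlow tendsto_const_nhds ?_ ?_ <;>
    · filter_upwards [eventually_ge_atTop 1] with ℓ hℓ
      have h1 : (1 : ℝ) ≤ ℓ := by exact_mod_cast hℓ
      have h2 : (ℓ : ℝ) ≤ 2 * ((ℓ - 1) / 2 : ℕ) + 2 := by exact_mod_cast (by omega)
      have h3 : 2 * (((ℓ - 1) / 2 : ℕ) : ℝ) ≤ ℓ := by exact_mod_cast (by omega)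
      have h4 : (ℓ : ℝ) * (ℓ : ℝ)⁻¹ = 1 := mul_inv_cancel₀ (by positivity)
      have h5 : 0 ≤ (ℓ : ℝ)⁻¹ := by positivity
      nlinarith [mul_le_mul_of_nonneg_right h2 h5, mul_le_mul_of_nonneg_right h3 h5]
  have hlog : Tendsto (fun ℓ : ℕ => Real.log (1 - μ⁻¹ ^ ℓ)) atTop (𝓝 0) := by
    have := (tendsto_pow_atTop_nhds_zero_of_lt_one hμ0.le hμ1).const_sub 1
    rw [sub_zero] at this
    simpa using this.log one_ne_zero
  have h := ((hhalf.const_mul (Real.log μ)).sub (hinv.const_mul (Real.log (1 - μ⁻¹)))).add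
    (hlog.mul hinv)
  simp only [mul_zero, sub_zero, add_zero, mul_one_div] at h
  refine h.congr' ?_
  filter_upwards [eventually_ge_atTop 1] with ℓ hℓ
  have hp : μ⁻¹ ^ ℓ < 1 := pow_lt_one₀ hμ0.le hμ1 (by omega)
  rw [Real.log_div (mul_pos (sub_pos.2 hμ1) (pow_pos hμ0 _)).ne' (sub_pos.2 hp).ne',
    Real.log_mul (sub_pos.2 hμ1).ne' (pow_pos hμ0 _).ne', Real.log_pow, Real.log_inv, div_neg,
    div_eq_mul_inv]
  ring

/-- If the number of vertices of height at most `n` grows by the factor `μ > 1` asymptotically, then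
the truncations of a leafless family tree have transfinite fractal dimension `log μ / 2`. -/
theorem hasTransfiniteDim_of_tendsto_ratio {k : List ℕ → ℕ} (hk : ∀ u, 1 ≤ k u) {μ : ℝ}
    (hμ : 1 < μ) (hlim : Tendsto (fun n : ℕ => ((ballLabels k (n + 1)).card : ℝ) /
      (ballLabels k n).card) atTop (𝓝 μ)) :
    HasTransfiniteDim (fun n : ℕ => truncGraph (familyTree k) (treeRoot k) n)
      (Real.log μ / 2) := by
  set S : ℕ → ℝ := fun n => (ballLabels k n).card
  set Z : ℕ → ℝ := fun n => (levelLabels k n).card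
  have hS (n : ℕ) : 0 < S n := Nat.cast_pos.2 ((Nat.zero_le n).trans_lt (lt_card_ballLabels hk n))
  have hZ (n : ℕ) : 0 < Z n := Nat.cast_pos.2 (card_levelLabels_pos hk n)
  have hZS (n : ℕ) : Z n ≤ S n := Nat.cast_le.2 <| Finset.card_le_card fun u hu =>
    mem_ballLabels.2 ⟨(mem_levelLabels.1 hu).1, (mem_levelLabels.1 hu).2.le⟩
  have hSZ (n : ℕ) : S (n + 1) = S n + Z (n + 1) := by
    simp only [S, Z, card_ballLabels_succ, Nat.cast_add]
  have hlim' : Tendsto (fun n => S n / S (n + 1)) atTop (𝓝 μ⁻¹) :=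
    (hlim.inv₀ (by positivity)).congr fun n => inv_div _ _
  have hSinv : Tendsto (fun n => (S n)⁻¹) atTop (𝓝 0) :=
    tendsto_inv_atTop_zero.comp (tendsto_natCast_atTop_atTop.comp
      (tendsto_atTop_mono (fun n => (lt_card_ballLabels hk n).le) tendsto_id))
  refine ⟨_, fun ℓ hℓ => ?_, tendsto_log_boxDensity_div hμ⟩
  have hμ1 : μ⁻¹ < 1 := inv_lt_one_of_one_lt₀ hμ
  have hμ0 : 0 < μ⁻¹ := by positivity
  have hp : μ⁻¹ ^ ℓ < 1 := pow_lt_one₀ hμ0.le hμ1 (by omega)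
  refine (Tendsto.log ?_ (div_pos (mul_pos (sub_pos.2 hμ1) (pow_pos hμ0 _))
    (sub_pos.2 hp)).ne').div_const _
  -- This choice gives 2r + 1 ≤ ℓ ≤ 2r + 2: the left inequality makes the boxes small enough, the
  -- right one separates the test vertices.
  set r := (ℓ - 1) / 2 with hr
  have hlow := tendsto_sum_centerLevels_div hS hZ hZS hSZ hμ hlim' (r := r) hℓ
  have hup := hlow.add hSinv
  rw [add_zero] at hup
  have hcard (n : ℕ) : ((centerLabels k n ℓ r).card : ℝ) =
      ∑ j ∈ centerLevels n ℓ r, Z (n - (r + ℓ * j)) := by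
    rw [card_centerLabels k hℓ, Nat.cast_sum]
  have hrs : r + (ℓ - 1 - r) + 1 = ℓ := by omega
  refine tendsto_of_tendsto_of_tendsto_of_le_of_le hlow hup (fun n => ?_) (fun n => ?_)
  · dsimp only
    rw [card_truncVerts, ← hcard]
    have := card_centerLabels_le_boxNumber (n := n) hk hrs (by omega) (by omega)
    gcongr
  · dsimp only
    rw [card_truncVerts, ← hcard, ← one_div, ← add_div]
    have := boxNumber_le_card_centerLabels_add_one (n := n) hk hrs (by omega)
    gcongr
    exact_mod_cast this

/-! ### Galton-Watson trees -/

/-- A divergent `tsum` is 0 by convention, so a positive mean is a genuine finite one. -/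
theorem integrable_natCast_of_offspringMean_pos {q : PMF ℕ} (h : 0 < offspringMean q) :
    Integrable (fun i : ℕ => (i : ℝ)) q.toMeasure := by
  have hs : Summable fun i : ℕ => (i : ℝ) * (q i).toReal := by
    by_contra hs
    exact h.ne' (tsum_eq_zero_of_not_summable hs)
  rw [← Measure.sum_smul_dirac q.toMeasure]
  refine integrable_sum_dirac (fun i => measure_ne_top _ _) (hs.congr fun i => ?_)
  rw [PMF.toMeasure_apply_singleton _ _ (measurableSet_singleton i), Real.norm_natCast, mul_comm]

/-- Let `ξ u`, for `u` in the Ulam-Harris set of labels, be independent offspring numbers with law `q`,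
so that `familyTree (fun u => ξ u ω)` is the Galton-Watson tree with offspring distribution `q`. -/
theorem mainTheorem3 {Ω : Type*} [MeasurableSpace Ω] (P : Measure Ω) [IsProbabilityMeasure P]
    (q : PMF ℕ) (ξ : List ℕ → Ω → ℕ)
    (hmeas : ∀ u, Measurable (ξ u))
    (hindep : iIndepFun ξ P)
    (hlaw : ∀ u, P.map (ξ u) = q.toMeasure)
    (hsuper : 1 < offspringMean q)
    (hq0 : q 0 = 0) (hq1 : q 1 ≠ 1)
    (hxlogx : Integrable (fun ω =>
      (generationSize (fun u => ξ u ω) 1 : ℝ) *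
        max (Real.log (generationSize (fun u => ξ u ω) 1 : ℝ)) 0) P) :
    ∀ᵐ ω ∂P, HasTransfiniteDim
      (fun n : ℕ => truncGraph (familyTree (fun u => ξ u ω)) (treeRoot (fun u => ξ u ω)) n)
      (Real.log (offspringMean q) / 2) := by
  have hint := integrable_natCast_of_offspringMean_pos (zero_lt_one.trans hsuper)
  have hmean : ∫ i, (i : ℝ) ∂q.toMeasure = offspringMean q := by
    rw [PMF.integral_eq_tsum q _ hint]
    simp only [offspringMean, smul_eq_mul, mul_comm]
  have hpos (u : List ℕ) : ∀ᵐ ω ∂P, 1 ≤ ξ u ω := by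
    have h : P (ξ u ⁻¹' {0}) = 0 := by
      rw [← Measure.map_apply (hmeas u) (measurableSet_singleton 0), hlaw,
        PMF.toMeasure_apply_singleton _ _ (measurableSet_singleton 0), hq0]
    filter_upwards [measure_eq_zero_iff_ae_notMem.1 h] with ω hω
    exact Nat.one_le_iff_ne_zero.2 hω
  -- The breadth-first lemmas need positive offspring numbers at every ω, so `ξ` is replaced by
  -- max(ξ, 1); almost surely the two agree at all of the countably many labels.
  have hmax : Measurable fun i : ℕ => max i 1 := measurable_from_top
  have hlaw' (u : List ℕ) : P.map (fun ω => max (ξ u ω) 1) = q.toMeasure := by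
    rw [← hlaw u]
    refine Measure.map_congr ?_
    filter_upwards [hpos u] with ω hω
    exact max_eq_left hω
  have h := tendsto_card_ballLabels_ratio (fun u => hmax.comp (hmeas u))
    (hindep.comp (fun _ i => max i 1) fun _ => hmax) hlaw' (fun _ _ => le_max_right _ _) hint
  filter_upwards [h, ae_all_iff.2 hpos] with ω hω hω'
  have heq : (fun u => max (ξ u ω) 1) = fun u => ξ u ω := funext fun u => max_eq_left (hω' u)
  simp only [Function.comp_apply, heq, hmean] at hω
  exact hasTransfiniteDim_of_tendsto_ratio hω' hsuper hω
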